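/- All varieties are over $\mathbb{C}$ and irreducible; algebraic vector fields on an affine variety $X$ are identified with $\mathbb{C}$-derivations of its algebra of regular functions $\mathbb{C}[X]$. Definitions. A vector field $\delta$ on $X$ is locally nilpotent if for every $f\in\mathbb{C}[X]$ there is $n$ with $\delta^n(f)=0$ (equivalently, its phase flow is an algebraic $\mathbb{C}_+$-action), and semi-simple if its phase flow generates an algebraic $\mathbb{C}^*$-action. Let $\delta_1,\delta_2$ be nontrivial vector fields such that $\delta_1$ is locally nilpotent and $\delta_2$ is locally nilpotent or semi-simple. They are called compatible on $X$ if (i) the vector space $\operatorname{Span}(\operatorname{Ker}\delta_1\cdot\operatorname{Ker}\delta_2)$ contains a nonzero ideal of $\mathbb{C}[X]$, and (ii) there is $a\in\operatorname{Ker}\delta_2$ with $\delta_1(a)\in\operatorname{Ker}\delta_1\setminus\{0\}$. An étale neighborhood of a point $y$ of a variety $Y$ is an étale morphism $g:W\to Y$ whose image contains $y$. Proposition 3.9. Let $X$ be a normal affine variety with nontrivial algebraic actions of $H_1\simeq\mathbb{C}_+$ and of $H_2\simeq\mathbb{C}_+$ or $H_2\simeq\mathbb{C}^*$, generating vector fields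 $\delta_1$ and $\delta_2$. Suppose that either $[\delta_1,\delta_2]=0$, and put $\Gamma=H_1\times H_2$; or $\delta_1,\delta_2$ are both locally nilpotent and generate a Lie algebra $\mathfrak{sl}_2$ that induces an algebraic action of $SL_2(\mathbb{C})$ on $X$, and put $\Gamma=SL_2(\mathbb{C})$. Let $Y$ be a normal affine variety with the trivial $\Gamma$-action and let $r:X\to Y$ be a surjective $\Gamma$-equivariant morphism. Suppose that for every $y\in Y$ there is an étale neighborhood $g:W\to Y$ of $y$ such that the fibred product $X\times_Y W$ is an (irreducible) affine variety and the vector fields induced on it by $\delta_1$ and $\delta_2$ are compatible. Then $\delta_1$ and $\delta_2$ are compatible on $X$. -/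

import Mathlib

universe u

namespace KalimanKutzschebauch

open CategoryTheory AlgebraicGeometry

/-! An affine variety `X` over `ℂ` is given by its algebra `A = ℂ[X]` of regular functions, a
finitely generated `ℂ`-algebra that is a domain; `X` is normal when `A` is integrally closed.
Algebraic vector fields on `X` are `ℂ`-linear derivations of `A`. A morphism `X ⟶ Y` is an algebra
map `ℂ[Y] → ℂ[X]`. A group acting on `X` acts on `A` by algebra automorphisms. -/

section VectorFields

variable {A : Type u} [CommRing A] [Algebra ℂ A]

/-- `δ` is a locally nilpotent derivation: every `f` is killed by some power of `δ`. -/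
def IsLocallyNilpotent (δ : Derivation ℂ A A) : Prop :=
  ∀ f : A, ∃ n : ℕ, (⇑δ)^[n] f = 0

/-- `φ` is an algebraic action of `ℂ₊` generated by the vector field `δ`: for every `f`, the
function `φ t f` is polynomial in `t`, and `δ f` is its derivative at `t = 0`. -/
def IsAddAction (φ : Multiplicative ℂ →* (A ≃ₐ[ℂ] A)) (δ : Derivation ℂ A A) : Prop :=
  ∀ f : A, ∃ p : Polynomial A,
    (∀ t : ℂ, φ (Multiplicative.ofAdd t) f = p.eval (algebraMap ℂ A t)) ∧ δ f = p.coeff 1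

/-- `φ` is an algebraic action of `ℂ^*` generated by the vector field `δ`: for every `f`, the
function `φ z f = ∑ zⁿ fₙ` is a Laurent polynomial in `z`, and `δ f` is its derivative `∑ n fₙ` at
`z = 1`, up to a constant `c ≠ 0` independent of `f`. So the phase flow of `δ` is
`t ↦ φ (exp (c t))`. -/
def IsMulAction (φ : ℂˣ →* (A ≃ₐ[ℂ] A)) (δ : Derivation ℂ A A) : Prop :=
  ∃ c : ℂ, c ≠ 0 ∧ ∀ f : A, ∃ p : ℤ →₀ A,
    (∀ z : ℂˣ, φ z f = p.sum fun n a => ((z ^ n : ℂˣ) : ℂ) • a) ∧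
      δ f = c • p.sum fun n a => (n : ℂ) • a

/-- `δ` is semi-simple: its phase flow generates an algebraic `ℂ^*`-action. -/
def IsSemisimple (δ : Derivation ℂ A A) : Prop :=
  ∃ φ : ℂˣ →* (A ≃ₐ[ℂ] A), IsMulAction φ δ

/-- `ψ` is an algebraic action of `SL₂(ℂ)` induced by the Lie algebra generated by `δ₁` and `δ₂`:
this Lie algebra is isomorphic to `sl₂` by some `θ`, for every `f` the function `ψ g f` is
polynomial in the entries of `g`, and the derivative of `ψ` at `1` in the direction `ξ ∈ sl₂` is
the vector field `θ ξ`. -/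
def IsSL2Action (ψ : Matrix.SpecialLinearGroup (Fin 2) ℂ →* (A ≃ₐ[ℂ] A))
    (δ₁ δ₂ : Derivation ℂ A A) : Prop :=
  ∃ θ : LieAlgebra.SpecialLinear.sl (Fin 2) ℂ ≃ₗ⁅ℂ⁆
      LieSubalgebra.lieSpan ℂ (Derivation ℂ A A) {δ₁, δ₂},
    ∀ f : A, ∃ p : MvPolynomial (Fin 2 × Fin 2) A,
      (∀ g : Matrix.SpecialLinearGroup (Fin 2) ℂ,
        ψ g f = MvPolynomial.eval
          (fun ij => algebraMap ℂ A ((g : Matrix (Fin 2) (Fin 2) ℂ) ij.1 ij.2)) p) ∧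
      ∀ ξ : LieAlgebra.SpecialLinear.sl (Fin 2) ℂ,
        (θ ξ : Derivation ℂ A A) f =
          ∑ ij : Fin 2 × Fin 2, (ξ : Matrix (Fin 2) (Fin 2) ℂ) ij.1 ij.2 •
            MvPolynomial.eval
              (fun kl => algebraMap ℂ A ((1 : Matrix (Fin 2) (Fin 2) ℂ) kl.1 kl.2))
              (MvPolynomial.pderiv ij p)

/-- The action of the group `Γ` attached to the vector fields `δ₁`, `δ₂`. Either `δ₁` and `δ₂`
commute and `Γ = H₁ × H₂`, where `H₁ = ℂ₊` and `H₂` is `ℂ₊` or `ℂ^*`, and `Hᵢ` acts with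
generating vector field `δᵢ`; or `δ₁` and `δ₂` are locally nilpotent, they generate a Lie algebra
`sl₂`, and `Γ = SL₂(ℂ)` acts accordingly. -/
inductive GammaAction (δ₁ δ₂ : Derivation ℂ A A) : Type u
  | addAdd (φ₁ φ₂ : Multiplicative ℂ →* (A ≃ₐ[ℂ] A)) (h₁ : IsAddAction φ₁ δ₁)
      (h₂ : IsAddAction φ₂ δ₂) (comm : ⁅δ₁, δ₂⁆ = 0)
  | addMul (φ₁ : Multiplicative ℂ →* (A ≃ₐ[ℂ] A)) (φ₂ : ℂˣ →* (A ≃ₐ[ℂ] A))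
      (h₁ : IsAddAction φ₁ δ₁) (h₂ : IsMulAction φ₂ δ₂) (comm : ⁅δ₁, δ₂⁆ = 0)
  | sl2 (ψ : Matrix.SpecialLinearGroup (Fin 2) ℂ →* (A ≃ₐ[ℂ] A))
      (h₁ : IsLocallyNilpotent δ₁) (h₂ : IsLocallyNilpotent δ₂) (h : IsSL2Action ψ δ₁ δ₂)

/-- The regular function `f` is fixed by every element of `Γ`. -/
def GammaAction.Fixes {δ₁ δ₂ : Derivation ℂ A A} : GammaAction δ₁ δ₂ → A → Prop
  | .addAdd φ₁ φ₂ _ _ _, f => ∀ h₁ h₂ : Multiplicative ℂ, φ₁ h₁ (φ₂ h₂ f) = f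
  | .addMul φ₁ φ₂ _ _ _, f => ∀ (h₁ : Multiplicative ℂ) (h₂ : ℂˣ), φ₁ h₁ (φ₂ h₂ f) = f
  | .sl2 ψ _ _ _, f => ∀ g : Matrix.SpecialLinearGroup (Fin 2) ℂ, ψ g f = f

/-- Compatibility of two vector fields. -/
structure Compatible (δ₁ δ₂ : Derivation ℂ A A) : Prop where
  ne_zero₁ : δ₁ ≠ 0
  ne_zero₂ : δ₂ ≠ 0
  locallyNilpotent₁ : IsLocallyNilpotent δ₁
  locallyNilpotent_or_semisimple₂ : IsLocallyNilpotent δ₂ ∨ IsSemisimple δ₂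
  /-- The span of `Ker δ₁ · Ker δ₂` contains a nonzero ideal. -/
  exists_ideal : ∃ I : Ideal A, I ≠ ⊥ ∧
    ∀ x ∈ I, x ∈ Submodule.span ℂ {z : A | ∃ f g : A, δ₁ f = 0 ∧ δ₂ g = 0 ∧ z = f * g}
  /-- Some element of `Ker δ₂` has degree one with respect to `δ₁`. -/
  exists_degree_one : ∃ a : A, δ₂ a = 0 ∧ δ₁ a ≠ 0 ∧ δ₁ (δ₁ a) = 0

end VectorFields

/-- Let `X = Spec A`, `Y = Spec B`. There is an étale neighbourhood `g : W ⟶ Y` of the point `y`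
such that the fibred product `X ×_Y W` is an affine variety `Spec R` (with `R` a domain) on which
the vector fields `D₁`, `D₂` induced by `δ₁`, `δ₂` are compatible. As `Spec R ⟶ X` is étale, `δᵢ`
has a unique extension `Dᵢ` to `R`. -/
def CompatibleEtaleNear {A B : Type u} [CommRing A] [CommRing B] [Algebra ℂ A] [Algebra B A]
    (δ₁ δ₂ : Derivation ℂ A A) (y : PrimeSpectrum B) : Prop :=
  ∃ (W : Scheme.{u}) (g : W ⟶ Spec (CommRingCat.of B)), Etale g ∧ y ∈ Set.range g ∧
    ∃ (R : Type u) (_ : CommRing R) (_ : IsDomain R) (_ : Algebra ℂ R) (_ : Algebra A R)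
      (_ : IsScalarTower ℂ A R) (q : Spec (CommRingCat.of R) ⟶ W),
      IsPullback (Spec.map (CommRingCat.ofHom (algebraMap A R))) q
        (Spec.map (CommRingCat.ofHom (algebraMap B A))) g ∧
      ∃ D₁ D₂ : Derivation ℂ R R,
        (∀ a : A, D₁ (algebraMap A R a) = algebraMap A R (δ₁ a)) ∧
        (∀ a : A, D₂ (algebraMap A R a) = algebraMap A R (δ₂ a)) ∧
        Compatible D₁ D₂

end KalimanKutzschebauch

namespace KalimanKutzschebauch

open CategoryTheory AlgebraicGeometry TensorProduct

/-! The action of Γ is trivial on B = ℂ[Y], so δ₁ and δ₂ kill B and are B-linear on A = ℂ[X].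
Compatibility can then be descended along flat B-algebras. Shrink the étale neighbourhood to an
affine Spec C; then C is flat over B and R embeds in A ⊗ C (`exists_affine_etale_neighbourhood`). As
R is unramified over A, this embedding carries Dᵢ to δᵢ ⊗ C (`rTensor_derivation_comp`), and by
flatness Ker(δᵢ ⊗ C) = (Ker δᵢ) ⊗ C.

Put S = Ker δ₁ · Ker δ₂, a B-submodule of A. The ideal given on R meets A in some c ≠ 0, so cA ⊗ 1
lies in the image of S ⊗ C, and cA lies in S locally on the image of Spec C. Finitely many such
images cover Spec B, and the product of the corresponding c generates a nonzero ideal contained in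
S. The element of degree one descends from a single neighbourhood. -/

/-- The chain rule along the line `a + t v`. -/
theorem coeff_one_aeval_line {A σ : Type*} [CommRing A] [Fintype σ] (a v : σ → A)
    (p : MvPolynomial σ A) :
    (MvPolynomial.aeval (fun i => Polynomial.C (a i) + Polynomial.C (v i) * Polynomial.X) p :
        Polynomial A).coeff 1 =
      ∑ i, v i * MvPolynomial.eval a (MvPolynomial.pderiv i p) := by
  have h0 : ∀ p : MvPolynomial σ A,
      (MvPolynomial.aeval (fun i => Polynomial.C (a i) + Polynomial.C (v i) * Polynomial.X) p :
        Polynomial A).coeff 0 = MvPolynomial.eval a p := by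
    intro p
    induction p using MvPolynomial.induction_on with
    | C c => simp
    | add p q hp hq => simp only [map_add, Polynomial.coeff_add, hp, hq]
    | mul_X p i hp => simp [Polynomial.mul_coeff_zero, hp]
  induction p using MvPolynomial.induction_on with
  | C c => simp
  | add p q hp hq =>
    simp only [map_add, Polynomial.coeff_add, hp, hq, mul_add, Finset.sum_add_distrib]
  | mul_X p i hp =>
    classical
    rw [map_mul, MvPolynomial.aeval_X, Polynomial.coeff_mul]
    rw [Finset.Nat.antidiagonal_succ]
    simp [h0, hp, Derivation.leibniz, MvPolynomial.pderiv_X, Pi.single_apply, mul_add,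
      Finset.sum_add_distrib, Finset.sum_mul, Polynomial.coeff_C]
    simp only [apply_ite (MvPolynomial.eval a), map_zero, mul_ite, mul_zero,
      Finset.sum_ite_eq, Finset.mem_univ, if_true]
    rw [add_comm, mul_comm (MvPolynomial.eval a p)]
    exact congrArg _ (Finset.sum_congr rfl fun _ _ => by rw [mul_right_comm, mul_assoc])

/-! ### Invariant functions are killed by the vector fields. -/

section Invariants

variable {A : Type u} [CommRing A] [IsDomain A] [Algebra ℂ A]

theorem eq_C_of_eval_algebraMap_eq {p : Polynomial A} {f : A}
    (h : ∀ t : ℂ, p.eval (algebraMap ℂ A t) = f) : p = Polynomial.C f := by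
  refine Polynomial.eq_of_infinite_eval_eq _ _ ?_
  refine (Set.infinite_range_of_injective (FaithfulSMul.algebraMap_injective ℂ A)).mono ?_
  rintro _ ⟨t, rfl⟩
  simp [h]

theorem IsAddAction.apply_eq_zero {φ : Multiplicative ℂ →* (A ≃ₐ[ℂ] A)} {δ : Derivation ℂ A A}
    (hφ : IsAddAction φ δ) {f : A} (hf : ∀ t, φ t f = f) : δ f = 0 := by
  obtain ⟨p, hp, hδ⟩ := hφ f
  have : p = Polynomial.C f :=
    eq_C_of_eval_algebraMap_eq fun t => by rw [← hp, hf]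
  rw [hδ, this, Polynomial.coeff_C_of_ne_zero one_ne_zero]

/-- Dedekind's independence of characters; it makes Laurent expansions over A unique. -/
theorem linearIndependent_zpow_units :
    LinearIndependent A fun (n : ℤ) (z : ℂˣ) => algebraMap ℂ A ((z ^ n : ℂˣ) : ℂ) := by
  let χ : ℤ → (ℂˣ →* A) := fun n =>
    ((algebraMap ℂ A : ℂ →* A).comp (Units.coeHom ℂ)).comp (zpowGroupHom n)
  have hχ : Function.Injective χ := by
    intro m n h
    have h2 := DFunLike.congr_fun h (Units.mk0 (2 : ℂ) two_ne_zero)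
    have h3 := FaithfulSMul.algebraMap_injective ℂ A h2
    have h4 : (2 : ℂ) ^ m = (2 : ℂ) ^ n := by simpa using h3
    have h5 : (2 : ℝ) ^ m = (2 : ℝ) ^ n := by simpa using congrArg norm h4
    exact zpow_right_injective₀ (by norm_num) (by norm_num) h5
  exact (linearIndependent_monoidHom ℂˣ A).comp χ hχ

theorem IsMulAction.apply_eq_zero {φ : ℂˣ →* (A ≃ₐ[ℂ] A)} {δ : Derivation ℂ A A}
    (hφ : IsMulAction φ δ) {f : A} (hf : ∀ z, φ z f = f) : δ f = 0 := by
  obtain ⟨c, -, h⟩ := hφ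
  obtain ⟨p, hp, hδ⟩ := h f
  have key : p = Finsupp.single 0 f := by
    refine linearIndependent_zpow_units (A := A) ?_
    rw [Finsupp.linearCombination_single, Finsupp.linearCombination_apply]
    ext z
    have h1 := (hp z).symm.trans (hf z)
    simp only [Finsupp.sum, Finset.sum_apply, Pi.smul_apply, smul_eq_mul, Algebra.smul_def]
      at h1 ⊢
    simp only [zpow_zero, Units.val_one, map_one, mul_one]
    rw [← h1]
    exact Finset.sum_congr rfl fun n _ => mul_comm _ _
  rw [hδ, key, Finsupp.sum_single_index (by simp)]
  simp

/-- A regular function on `SL₂` that is constant has zero derivative at `1` along a nilpotent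
matrix. -/
theorem sum_smul_pderiv_eq_zero_of_nilpotent {p : MvPolynomial (Fin 2 × Fin 2) A} {f : A}
    (h : ∀ g : Matrix.SpecialLinearGroup (Fin 2) ℂ,
      MvPolynomial.eval
        (fun ij => algebraMap ℂ A ((g : Matrix (Fin 2) (Fin 2) ℂ) ij.1 ij.2)) p = f)
    (N : Matrix (Fin 2) (Fin 2) ℂ) (hN : ∀ t : ℂ, (1 + t • N).det = 1) :
    ∑ ij : Fin 2 × Fin 2, N ij.1 ij.2 •
      MvPolynomial.eval
        (fun kl => algebraMap ℂ A ((1 : Matrix (Fin 2) (Fin 2) ℂ) kl.1 kl.2))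
        (MvPolynomial.pderiv ij p) = 0 := by
  have key := coeff_one_aeval_line
    (fun kl : Fin 2 × Fin 2 => algebraMap ℂ A ((1 : Matrix (Fin 2) (Fin 2) ℂ) kl.1 kl.2))
    (fun kl => algebraMap ℂ A (N kl.1 kl.2)) p
  simp only [Algebra.smul_def]
  rw [← key]
  refine (congrArg (fun r => Polynomial.coeff r 1)
    (eq_C_of_eval_algebraMap_eq (f := f) fun t => ?_)).trans
    (Polynomial.coeff_C_of_ne_zero one_ne_zero)
  rw [← h ⟨1 + t • N, hN t⟩, ← Polynomial.coe_evalRingHom, MvPolynomial.aeval_def,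
    MvPolynomial.hom_eval₂, MvPolynomial.eval, MvPolynomial.coe_eval₂Hom]
  congr 1
  · ext; simp
  · ext ij
    rw [Polynomial.coe_evalRingHom]
    simp only [Polynomial.eval_add, Polynomial.eval_mul, Polynomial.eval_C, Polynomial.eval_X,
      Matrix.add_apply, Matrix.smul_apply, smul_eq_mul, map_add, map_mul]
    rw [mul_comm]

/-- sl₂ is spanned by nilpotent matrices, along which the derivative of a constant orbit map
vanishes. -/
theorem IsSL2Action.apply_eq_zero {ψ : Matrix.SpecialLinearGroup (Fin 2) ℂ →* (A ≃ₐ[ℂ] A)}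
    {δ₁ δ₂ : Derivation ℂ A A} (hψ : IsSL2Action ψ δ₁ δ₂) {f : A} (hf : ∀ g, ψ g f = f)
    {δ : Derivation ℂ A A} (hδ : δ ∈ ({δ₁, δ₂} : Set (Derivation ℂ A A))) : δ f = 0 := by
  obtain ⟨θ, h⟩ := hψ
  obtain ⟨p, hp, hθ⟩ := h f
  have hp' := fun g => (hp g).symm.trans (hf g)
  obtain ⟨ξ, hξ⟩ := θ.surjective ⟨δ, LieSubalgebra.subset_lieSpan hδ⟩
  have htr : (ξ : Matrix (Fin 2) (Fin 2) ℂ) 0 0 + (ξ : Matrix (Fin 2) (Fin 2) ℂ) 1 1 = 0 := by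
    have : Matrix.trace (ξ : Matrix (Fin 2) (Fin 2) ℂ) = 0 := ξ.2
    rwa [Matrix.trace_fin_two] at this
  have e := sum_smul_pderiv_eq_zero_of_nilpotent hp' !![0, 1; 0, 0]
    (fun t => by simp [Matrix.det_fin_two])
  have e' := sum_smul_pderiv_eq_zero_of_nilpotent hp' !![0, 0; 1, 0]
    (fun t => by simp [Matrix.det_fin_two])
  -- This nilpotent is H - E + F with H = diag(1, -1), so with E and F it spans sl₂.
  have e'' := sum_smul_pderiv_eq_zero_of_nilpotent hp' !![1, -1; 1, -1]
    (fun t => by simp [Matrix.det_fin_two]; ring)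
  have hδθ := hθ ξ
  have hξ' : ((θ ξ : LieSubalgebra.lieSpan ℂ (Derivation ℂ A A) {δ₁, δ₂}) :
      Derivation ℂ A A) = δ := congrArg Subtype.val hξ
  rw [hξ'] at hδθ
  rw [hδθ]
  simp only [Fintype.sum_prod_type, Fin.sum_univ_two, Matrix.of_apply, Matrix.cons_val_zero,
    Matrix.cons_val_one, Matrix.cons_val', Matrix.cons_val_fin_one, zero_smul, one_smul,
    zero_add, add_zero, neg_smul] at e e' e'' ⊢
  rw [e, e'] at e'' ⊢
  rw [eq_neg_of_add_eq_zero_right htr]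
  simp only [smul_zero, zero_add, add_zero, neg_zero, neg_smul] at e'' ⊢
  rw [← smul_neg, ← smul_add, e'', smul_zero]

theorem GammaAction.Fixes.apply_eq_zero {δ₁ δ₂ : Derivation ℂ A A} {Γ : GammaAction δ₁ δ₂} {f : A}
    (hf : Γ.Fixes f) : δ₁ f = 0 ∧ δ₂ f = 0 := by
  cases Γ with
  | addAdd φ₁ φ₂ h₁ h₂ comm =>
    exact ⟨h₁.apply_eq_zero fun t => by simpa using hf t 1,
      h₂.apply_eq_zero fun t => by simpa using hf 1 t⟩
  | addMul φ₁ φ₂ h₁ h₂ comm =>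
    exact ⟨h₁.apply_eq_zero fun t => by simpa using hf t 1,
      h₂.apply_eq_zero fun t => by simpa using hf 1 t⟩
  | sl2 ψ h₁ h₂ h =>
    exact ⟨h.apply_eq_zero hf (by simp), h.apply_eq_zero hf (by simp)⟩

end Invariants

/-! ### Flat and étale extensions of domains; affine étale neighbourhoods. -/

theorem injective_algebraMap_of_flat {A R : Type*} [CommRing A] [IsDomain A] [CommRing R]
    [Nontrivial R] [Algebra A R] [Module.Flat A R] : Function.Injective (algebraMap A R) := by
  rw [injective_iff_map_eq_zero]
  intro a ha
  by_contra h
  have hreg : IsSMulRegular A a := by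
    intro x y hxy
    exact mul_left_cancel₀ h hxy
  have := hreg.of_flat (S := R)
  have h1 : (1 : R) = 0 := this (by simp [ha])
  exact one_ne_zero h1

/-- An étale algebra over the fraction field K is finite, and flatness embeds R in K ⊗ R. -/
theorem isAlgebraic_of_etale {A R : Type*} [CommRing A] [IsDomain A] [CommRing R]
    [Algebra A R] [Algebra.Etale A R] [Module.Flat A R] (r : R) : IsAlgebraic A r := by
  let K := FractionRing A
  have : Module.Finite K (K ⊗[A] R) := Algebra.FormallyUnramified.finite_of_free K (K ⊗[A] R)
  have h1 : IsAlgebraic K ((1 : K) ⊗ₜ[A] r) := (Algebra.IsIntegral.isIntegral _).isAlgebraic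
  have h2 : IsAlgebraic A ((1 : K) ⊗ₜ[A] r) :=
    (IsFractionRing.isAlgebraic_iff A K (K ⊗[A] R)).2 h1
  have h3 : Function.Injective (Algebra.TensorProduct.includeRight : R →ₐ[A] K ⊗[A] R) :=
    Algebra.TensorProduct.includeRight_injective (IsFractionRing.injective A K)
  exact (isAlgebraic_algHom_iff _ h3).1 h2

/-- If `Spec R = X ×_Y W` for a scheme `W` étale over `Y`, then a point `y` in the image of `W` has
an affine étale neighbourhood `Spec B'`, open in `W`, and `R` embeds into the algebra of
`X ×_Y Spec B'`. -/
theorem exists_affine_etale_neighbourhood {A B R : Type u} [CommRing A] [CommRing B]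
    [Algebra B A] (hBA : Function.Injective (algebraMap B A))
    [CommRing R] [IsDomain R] [Algebra A R] {W : Scheme.{u}}
    (g : W ⟶ Spec (CommRingCat.of B)) [Etale g] {y : PrimeSpectrum B} (hy : y ∈ Set.range g)
    (q : Spec (CommRingCat.of R) ⟶ W)
    (hq : IsPullback (Spec.map (CommRingCat.ofHom (algebraMap A R))) q
        (Spec.map (CommRingCat.ofHom (algebraMap B A))) g) :
    ∃ (B' : Type u) (_ : CommRing B') (_ : Algebra B B'), Module.Flat B B' ∧
      IsOpen (Set.range (PrimeSpectrum.comap (algebraMap B B'))) ∧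
      y ∈ Set.range (PrimeSpectrum.comap (algebraMap B B')) ∧
      ∃ ρ : R →ₐ[A] A ⊗[B] B', Function.Injective ρ := by
  obtain ⟨w, rfl⟩ := hy
  obtain ⟨U, hU, hwU, -⟩ := exists_isAffineOpen_mem_and_subset (x := w) (U := ⊤) trivial
  let C : CommRingCat.{u} := W.presheaf.obj (Opposite.op U)
  let j : Spec C ⟶ W := hU.fromSpec
  let f : CommRingCat.of B ⟶ C := Spec.preimage (j ≫ g)
  have hf : Spec.map f = j ≫ g := Spec.map_preimage _
  let _ : Algebra B C := f.hom.toAlgebra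
  have hfe : CommRingCat.ofHom (algebraMap B C) = f := rfl
  have het : Etale (Spec.map f) := by rw [hf]; infer_instance
  have hflat : Module.Flat B C := by
    have h1 : Flat (Spec.map f) := inferInstance
    exact Flat.SpecMap_iff.1 h1
  have hw : w ∈ Set.range j := by
    rw [hU.range_fromSpec]; exact hwU
  obtain ⟨x, rfl⟩ := hw
  have hnt : Nontrivial C := PrimeSpectrum.nontrivial (R := C) x
  have hopen : IsOpen (Set.range (Spec.map f)) := (Spec.map f).isOpenMap.isOpen_range
  refine ⟨C, inferInstance, inferInstance, hflat, hopen, ⟨x, ?_⟩, ?_⟩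
  · change Spec.map f x = _
    rw [hf]; rfl
  have hT : IsPullback
      (Spec.map (CommRingCat.ofHom
        (Algebra.TensorProduct.includeLeftRingHom : A →+* A ⊗[B] C)))
      (Spec.map (CommRingCat.ofHom
        (Algebra.TensorProduct.includeRight : C →ₐ[B] A ⊗[B] C).toRingHom))
      (Spec.map (CommRingCat.ofHom (algebraMap B A))) (j ≫ g) := by
    rw [← hf]
    exact isPullback_SpecMap_of_isPushout _ _ _ _ (CommRingCat.isPushout_tensorProduct B A C)
  let l := hq.lift _ _ (hT.w.trans (Category.assoc _ _ _).symm)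
  have hl₁ := hq.lift_fst _ _ (hT.w.trans (Category.assoc _ _ _).symm)
  have hl₂ := hq.lift_snd _ _ (hT.w.trans (Category.assoc _ _ _).symm)
  -- By pasting of pullbacks, `l` is a base change of the open immersion `j`, hence an open
  -- immersion and flat.
  have hleft : IsPullback l _ q j :=
    IsPullback.of_right (by rw [show l ≫ _ = _ from hl₁]; exact hT) hl₂ hq
  have hlo : IsOpenImmersion l := MorphismProperty.of_isPullback hleft.flip inferInstance
  have hρ : Spec.map (Spec.preimage l) = l := Spec.map_preimage _
  have hcomp : CommRingCat.ofHom (algebraMap A R) ≫ Spec.preimage l =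
      CommRingCat.ofHom (Algebra.TensorProduct.includeLeftRingHom : A →+* A ⊗[B] C) := by
    apply Spec.map_injective
    rw [Spec.map_comp, hρ]
    exact hl₁
  let ρ : R →ₐ[A] A ⊗[B] C :=
    { (Spec.preimage l).hom with
      commutes' := fun a => congrArg (fun φ => φ.hom a) hcomp }
  refine ⟨ρ, ?_⟩
  have : Nontrivial (A ⊗[B] C) :=
    (Algebra.TensorProduct.includeRight_injective (A := A) (B := C) hBA).nontrivial
  have hlf : Flat (Spec.map (Spec.preimage l)) := by rw [hρ]; infer_instance
  let _ : Algebra R (A ⊗[B] C) := (Spec.preimage l).hom.toAlgebra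
  have : Module.Flat R (A ⊗[B] C) := Flat.SpecMap_iff.1 hlf
  exact injective_algebraMap_of_flat (A := R) (R := A ⊗[B] C)

/-- Such an `e` is an A-derivation along `ρ`, so it factors through Ω of R over A, which is zero. It
is used to identify two extensions of one derivation. -/
theorem eq_zero_of_formallyUnramified {A R T : Type*} [CommRing A] [CommRing R] [CommRing T]
    [Algebra A R] [Algebra A T] [Algebra.FormallyUnramified A R] (ρ : R →ₐ[A] T) (e : R →+ T)
    (hmul : ∀ x y, e (x * y) = ρ x * e y + ρ y * e x) (h0 : ∀ a, e (algebraMap A R a) = 0)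
    (x : R) : e x = 0 := by
  let _ : Algebra R T := ρ.toRingHom.toAlgebra
  have hsmul : ∀ (r : R) (t : T), r • t = ρ r * t := fun _ _ => rfl
  have : IsScalarTower A R T := .of_algebraMap_eq fun a => (ρ.commutes a).symm
  let l : R →ₗ[A] T :=
    { e with
      map_smul' := fun a r => by
        simp [Algebra.smul_def, hmul, h0] }
  let D : Derivation A R T := Derivation.mk' l hmul
  have h := D.liftKaehlerDifferential_comp_D x
  rw [Subsingleton.elim (KaehlerDifferential.D A R x) 0, map_zero] at h
  exact h.symm

/-! ### Kernels and submodules under flat base change. -/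

section BaseChange

variable {A B C : Type*} [CommRing A] [CommRing B] [CommRing C] [Algebra B A] [Algebra B C]

theorem rTensor_derivation_mul (d : Derivation B A A) (x y : A ⊗[B] C) :
    (d : A →ₗ[B] A).rTensor C (x * y) =
      x * (d : A →ₗ[B] A).rTensor C y + y * (d : A →ₗ[B] A).rTensor C x := by
  induction x with
  | zero => simp
  | add x x' hx hx' => rw [add_mul, map_add, hx, hx', map_add]; ring
  | tmul a c =>
    induction y with
    | zero => simp
    | add y y' hy hy' => rw [mul_add, map_add, hy, hy', map_add]; ring
    | tmul a' c' =>
      simp [Derivation.leibniz, add_tmul, mul_comm]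

/-- A derivation of an unramified extension `R` of `A` that extends a `B`-linear derivation of `A`
is compatible with the base change of the latter. -/
theorem rTensor_derivation_comp {R : Type*} [CommRing R] [Algebra A R]
    [Algebra.FormallyUnramified A R] [Algebra ℂ R] (ρ : R →ₐ[A] A ⊗[B] C) (d : Derivation B A A)
    (D : Derivation ℂ R R) (hD : ∀ a, D (algebraMap A R a) = algebraMap A R (d a)) (x : R) :
    (d : A →ₗ[B] A).rTensor C (ρ x) = ρ (D x) := by
  refine sub_eq_zero.1 (eq_zero_of_formallyUnramified ρ
    (((d : A →ₗ[B] A).rTensor C).toAddMonoidHom.comp (ρ : R →+ A ⊗[B] C) -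
      (ρ : R →+ A ⊗[B] C).comp (D : R →+ R)) ?_ ?_ x)
  · intro x y
    simp only [AddMonoidHom.sub_apply, AddMonoidHom.comp_apply, LinearMap.toAddMonoidHom_coe,
      AddMonoidHom.coe_coe, map_mul, rTensor_derivation_mul, Derivation.leibniz, map_add,
      smul_eq_mul]
    ring
  · intro a
    simp [hD]

theorem mem_range_rTensor_ker {M N : Type*} [AddCommGroup M] [AddCommGroup N] [Module B M]
    [Module B N] [Module.Flat B C] (f : M →ₗ[B] N) {x : M ⊗[B] C} (hx : f.rTensor C x = 0) :
    x ∈ LinearMap.range ((LinearMap.ker f).subtype.rTensor C) :=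
  (Module.Flat.rTensor_exact C f.exact_subtype_ker_map x).1 hx

theorem mul_mem_range_rTensor {S T : Submodule B A} {x y : A ⊗[B] C}
    (hx : x ∈ LinearMap.range (S.subtype.rTensor C))
    (hy : y ∈ LinearMap.range (T.subtype.rTensor C)) :
    x * y ∈ LinearMap.range ((S * T).subtype.rTensor C) := by
  obtain ⟨x, rfl⟩ := hx
  obtain ⟨y, rfl⟩ := hy
  induction x with
  | zero => simp
  | add x x' hx hx' => rw [map_add, add_mul]; exact add_mem hx hx'
  | tmul a c =>
    induction y with
    | zero => simp
    | add y y' hy hy' => rw [map_add, mul_add]; exact add_mem hy hy'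
    | tmul a' c' =>
      exact ⟨⟨a * a', Submodule.mul_mem_mul a.2 a'.2⟩ ⊗ₜ (c * c'), by simp⟩

/-- Flat descent of membership in a submodule: the locus where `x` lies in `S` is detected by the
flat `B`-algebras whose spectrum meets it. -/
theorem colon_not_le_of_mem_range_rTensor {M : Type*} [AddCommGroup M] [Module B M]
    [Module.Flat B C] (S : Submodule B M) {x : M}
    (hx : x ⊗ₜ[B] (1 : C) ∈ LinearMap.range (S.subtype.rTensor C)) (Q : PrimeSpectrum C) :
    ∃ b : B, b • x ∈ S ∧ b ∉ (PrimeSpectrum.comap (algebraMap B C) Q).asIdeal := by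
  by_contra! hcon
  -- The kernel of `f` is the colon ideal (S : x). By flatness 1 lies in its extension to C, which
  -- `hcon` would put inside `Q`.
  let f : B →ₗ[B] M ⧸ S := LinearMap.toSpanSingleton B _ (S.mkQ x)
  have h1 : f.rTensor C (1 ⊗ₜ 1) = 0 := by
    obtain ⟨z, hz⟩ := hx
    have : f.rTensor C (1 ⊗ₜ 1) = S.mkQ.rTensor C (x ⊗ₜ 1) := by simp [f]
    rw [this, ← hz, ← LinearMap.comp_apply, ← LinearMap.rTensor_comp]
    have h0 : S.mkQ ∘ₗ S.subtype = 0 := by ext; simp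
    rw [h0]; simp
  obtain ⟨z, hz⟩ := mem_range_rTensor_ker (C := C) f h1
  have key : ∀ z : LinearMap.ker f ⊗[B] C,
      Algebra.TensorProduct.lid B C ((LinearMap.ker f).subtype.rTensor C z) ∈ Q.asIdeal := by
    intro z
    induction z with
    | zero => simp
    | add z z' hz hz' => rw [map_add, map_add]; exact add_mem hz hz'
    | tmul b c =>
      have hb : (b : B) • x ∈ S := by
        have := b.2
        simpa [f, ← Submodule.Quotient.mk_smul] using this
      have := hcon _ hb
      simpa [Algebra.smul_def] using Q.asIdeal.mul_mem_right c this
  have := key z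
  rw [hz] at this
  exact Q.isPrime.ne_top ((Ideal.eq_top_iff_one _).2 (by simpa using this))

end BaseChange

/-! ### Descent of the two compatibility conditions. -/

section Descent

variable {A B C R : Type*} [CommRing A] [CommRing B] [CommRing C] [CommRing R] [Algebra B A]
  [Algebra B C] [Module.Flat B C] [Algebra A R] [Algebra ℂ R] [Algebra.FormallyUnramified A R]

/-- If d₁ vanished on Ker d₁² ∩ Ker d₂, then d₁ ⊗ C would vanish on its base change, which by
flatness contains the image of the given element of R. -/
theorem exists_degree_one_of_flat (ρ : R →ₐ[A] A ⊗[B] C) (hρ : Function.Injective ρ)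
    (d₁ d₂ : Derivation B A A) {D₁ D₂ : Derivation ℂ R R}
    (hD₁ : ∀ a, D₁ (algebraMap A R a) = algebraMap A R (d₁ a))
    (hD₂ : ∀ a, D₂ (algebraMap A R a) = algebraMap A R (d₂ a))
    (h : ∃ a : R, D₂ a = 0 ∧ D₁ a ≠ 0 ∧ D₁ (D₁ a) = 0) :
    ∃ a : A, d₂ a = 0 ∧ d₁ a ≠ 0 ∧ d₁ (d₁ a) = 0 := by
  obtain ⟨r, hr₂, hr₁, hr₁₁⟩ := h
  by_contra! hcon
  let e : A →ₗ[B] A := d₁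
  let K := LinearMap.ker (d₂ : A →ₗ[B] A)
  have he : ∀ x, e.rTensor C (ρ x) = ρ (D₁ x) := rTensor_derivation_comp ρ d₁ D₁ hD₁
  obtain ⟨z, hz⟩ : ρ r ∈ LinearMap.range (K.subtype.rTensor C) :=
    mem_range_rTensor_ker _ (by rw [rTensor_derivation_comp ρ d₂ D₂ hD₂, hr₂, map_zero])
  let f : K →ₗ[B] A := e ∘ₗ e ∘ₗ K.subtype
  have hf : f.rTensor C z = 0 := by
    simp only [f, LinearMap.rTensor_comp, LinearMap.comp_apply, hz, he, hr₁₁, map_zero]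
  obtain ⟨t, rfl⟩ := mem_range_rTensor_ker f hf
  have h0 : e ∘ₗ K.subtype ∘ₗ (LinearMap.ker f).subtype = 0 := by
    ext a
    by_contra hne
    exact hcon a.1 a.1.2 hne a.2
  apply hr₁
  apply hρ
  rw [map_zero, ← he, ← hz, ← LinearMap.comp_apply, ← LinearMap.comp_apply,
    ← LinearMap.rTensor_comp, ← LinearMap.rTensor_comp, LinearMap.comp_assoc, h0]
  simp

variable [Algebra ℂ A]

theorem mem_span_of_mem_ker_mul_ker (d₁ d₂ : Derivation B A A) {x : A}
    (hx : x ∈ LinearMap.ker (d₁ : A →ₗ[B] A) * LinearMap.ker (d₂ : A →ₗ[B] A)) :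
    x ∈ Submodule.span ℂ {z : A | ∃ f g : A, d₁ f = 0 ∧ d₂ g = 0 ∧ z = f * g} := by
  refine Submodule.mul_induction_on hx (fun f hf g hg => ?_) fun x y hx hy => add_mem hx hy
  exact Submodule.subset_span ⟨f, g, hf, hg, rfl⟩

variable [Algebra ℂ B] [IsScalarTower ℂ B A] [IsScalarTower ℂ A R]

theorem mem_range_rTensor_of_mem_span (ρ : R →ₐ[A] A ⊗[B] C) (d₁ d₂ : Derivation B A A)
    {D₁ D₂ : Derivation ℂ R R}
    (hD₁ : ∀ a, D₁ (algebraMap A R a) = algebraMap A R (d₁ a))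
    (hD₂ : ∀ a, D₂ (algebraMap A R a) = algebraMap A R (d₂ a)) {x : R}
    (hx : x ∈ Submodule.span ℂ {z : R | ∃ f g : R, D₁ f = 0 ∧ D₂ g = 0 ∧ z = f * g}) :
    ρ x ∈ LinearMap.range
      ((LinearMap.ker (d₁ : A →ₗ[B] A) * LinearMap.ker (d₂ : A →ₗ[B] A)).subtype.rTensor C) := by
  induction hx using Submodule.span_induction with
  | zero => simp
  | add x y _ _ hx hy => rw [map_add]; exact add_mem hx hy
  | mem x hx =>
    obtain ⟨f, g, hf, hg, rfl⟩ := hx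
    rw [map_mul]
    refine mul_mem_range_rTensor (mem_range_rTensor_ker _ ?_) (mem_range_rTensor_ker _ ?_)
    · rw [rTensor_derivation_comp ρ d₁ D₁ hD₁, hf, map_zero]
    · rw [rTensor_derivation_comp ρ d₂ D₂ hD₂, hg, map_zero]
  | smul z x _ hx =>
    have : ρ (z • x) = algebraMap ℂ B z • ρ x := by
      rw [Algebra.smul_def, IsScalarTower.algebraMap_apply ℂ A R, map_mul, ρ.commutes,
        IsScalarTower.algebraMap_apply ℂ B A, ← IsScalarTower.algebraMap_apply B A (A ⊗[B] C),
        ← Algebra.smul_def]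
    rw [this]
    exact Submodule.smul_mem _ _ hx

end Descent

/-- What compatibility on an étale neighbourhood of `y` yields on `X`, up to flat descent. -/
theorem CompatibleEtaleNear.exists_flat {A B : Type u} [CommRing A] [IsDomain A] [CommRing B]
    [Algebra ℂ A] [Algebra ℂ B] [Algebra B A] [IsScalarTower ℂ B A]
    (hBA : Function.Injective (algebraMap B A)) {δ₁ δ₂ : Derivation ℂ A A}
    (d₁ d₂ : Derivation B A A) (hd₁ : ∀ a, d₁ a = δ₁ a) (hd₂ : ∀ a, d₂ a = δ₂ a)
    {y : PrimeSpectrum B} (h : CompatibleEtaleNear δ₁ δ₂ y) :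
    (∃ a : A, δ₂ a = 0 ∧ δ₁ a ≠ 0 ∧ δ₁ (δ₁ a) = 0) ∧
    ∃ (C : Type u) (_ : CommRing C) (_ : Algebra B C), Module.Flat B C ∧
      IsOpen (Set.range (PrimeSpectrum.comap (algebraMap B C))) ∧
      y ∈ Set.range (PrimeSpectrum.comap (algebraMap B C)) ∧
      ∃ c : A, c ≠ 0 ∧ ∀ a : A, (c * a) ⊗ₜ[B] (1 : C) ∈ LinearMap.range
        ((LinearMap.ker (d₁ : A →ₗ[B] A) * LinearMap.ker (d₂ : A →ₗ[B] A)).subtype.rTensor C) := by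
  obtain ⟨W, g, hg, hy, R, _, _, _, _, _, q, hq, D₁, D₂, hD₁, hD₂, hD⟩ := h
  obtain ⟨C, _, _, hflat, hopen, hyC, ρ, hρ⟩ := exists_affine_etale_neighbourhood hBA g hy q hq
  have het : AlgebraicGeometry.Etale
      (AlgebraicGeometry.Spec.map (CommRingCat.ofHom (algebraMap A R))) :=
    CategoryTheory.MorphismProperty.of_isPullback hq.flip hg
  have het' : Algebra.Etale A R := RingHom.etale_algebraMap.1
    (AlgebraicGeometry.HasRingHomProperty.Spec_iff.1 het)
  have : Module.Flat A R := inferInstance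
  simp only [← hd₁, ← hd₂] at hD₁ hD₂ ⊢
  refine ⟨exists_degree_one_of_flat ρ hρ d₁ d₂ hD₁ hD₂ hD.exists_degree_one,
    C, inferInstance, inferInstance, hflat, hopen, hyC, ?_⟩
  obtain ⟨J, hJ, hJs⟩ := hD.exists_ideal
  obtain ⟨x, hxJ, hx0⟩ := Submodule.exists_mem_ne_zero_of_ne_bot hJ
  -- R is a domain algebraic over A, so a nonzero ideal of R contracts to a nonzero ideal of A.
  obtain ⟨c, hc, hc0⟩ := Submodule.exists_mem_ne_zero_of_ne_bot
    (Ideal.comap_ne_bot_of_algebraic_mem hx0 hxJ (isAlgebraic_of_etale (A := A) x))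
  refine ⟨c, hc0, fun a => ?_⟩
  have := mem_range_rTensor_of_mem_span ρ d₁ d₂ hD₁ hD₂
    (hJs _ (J.mul_mem_right (algebraMap A R a) hc))
  rwa [← map_mul, ρ.commutes, Algebra.TensorProduct.algebraMap_apply, Algebra.algebraMap_self,
    RingHom.id_apply] at this

/-! ### Globalisation over Y. -/

theorem injective_algebraMap_of_surjective_comap {A B : Type*} [CommRing A] [CommRing B]
    [IsDomain B] [Algebra B A]
    (h : Function.Surjective (PrimeSpectrum.comap (algebraMap B A))) :
    Function.Injective (algebraMap B A) := by
  rw [injective_iff_map_eq_zero]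
  intro b hb
  obtain ⟨P, hP⟩ := h ⊥
  have : b ∈ (PrimeSpectrum.comap (algebraMap B A) P).asIdeal := by
    simp [hb]
  rwa [hP] at this

/-- A derivation killing the base is linear over it. -/
theorem exists_derivation_of_algebraMap_eq_zero {A B : Type*} [CommRing A] [CommRing B]
    [Algebra ℂ A] [Algebra B A] (δ : Derivation ℂ A A) (h : ∀ b : B, δ (algebraMap B A b) = 0) :
    ∃ d : Derivation B A A, ∀ a, d a = δ a :=
  ⟨Derivation.mk'
    { (δ : A →+ A) with map_smul' := fun b a => by simp [Algebra.smul_def, h] }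
    fun a b => δ.leibniz a b, fun _ => rfl⟩

/-- A union of open sets containing all closed points of `Spec B` has a finite subcover. -/
theorem exists_finset_cover_of_isMaximal {B : Type*} [CommRing B] {ι : Type*}
    (U : ι → Set (PrimeSpectrum B)) (hU : ∀ i, IsOpen (U i))
    (h : ∀ y : PrimeSpectrum B, y.asIdeal.IsMaximal → ∃ i, y ∈ U i) :
    ∃ s : Finset ι, ∀ y, ∃ i ∈ s, y ∈ U i := by
  obtain ⟨s, hs⟩ := isCompact_univ.elim_finite_subcover U hU (by
    intro y _
    -- Open sets are stable under generization, so a closed specialization of `y` suffices.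
    obtain ⟨m, hm, hym⟩ := Ideal.exists_le_maximal y.asIdeal y.isPrime.ne_top
    obtain ⟨i, hi⟩ := h ⟨m, hm.isPrime⟩ hm
    refine Set.mem_iUnion.2 ⟨i, ?_⟩
    exact ((PrimeSpectrum.le_iff_specializes y ⟨m, hm.isPrime⟩).1 hym).mem_open (hU i) hi)
  exact ⟨s, fun y => by simpa using hs (Set.mem_univ y)⟩

end KalimanKutzschebauch

theorem proposition3p9 {A B : Type u}
    [CommRing A] [IsDomain A] [IsIntegrallyClosed A] [Algebra ℂ A] [Algebra.FiniteType ℂ A]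
    [CommRing B] [IsDomain B] [IsIntegrallyClosed B] [Algebra ℂ B] [Algebra.FiniteType ℂ B]
    [Algebra B A] [IsScalarTower ℂ B A]
    (δ₁ δ₂ : Derivation ℂ A A) (hne₁ : δ₁ ≠ 0) (hne₂ : δ₂ ≠ 0)
    (h₁ : KalimanKutzschebauch.IsLocallyNilpotent δ₁)
    (h₂ : KalimanKutzschebauch.IsLocallyNilpotent δ₂ ∨ KalimanKutzschebauch.IsSemisimple δ₂)
    (Γ : KalimanKutzschebauch.GammaAction δ₁ δ₂)
    (hequivariant : ∀ b : B, Γ.Fixes (algebraMap B A b))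
    (hsurjective : Function.Surjective (PrimeSpectrum.comap (algebraMap B A)))
    (hlocal : ∀ y : PrimeSpectrum B, y.asIdeal.IsMaximal →
      KalimanKutzschebauch.CompatibleEtaleNear δ₁ δ₂ y) :
    KalimanKutzschebauch.Compatible δ₁ δ₂ := by
  have hBA := KalimanKutzschebauch.injective_algebraMap_of_surjective_comap hsurjective
  obtain ⟨d₁, hd₁⟩ := KalimanKutzschebauch.exists_derivation_of_algebraMap_eq_zero (B := B) δ₁
    fun b => (hequivariant b).apply_eq_zero.1
  obtain ⟨d₂, hd₂⟩ := KalimanKutzschebauch.exists_derivation_of_algebraMap_eq_zero (B := B) δ₂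
    fun b => (hequivariant b).apply_eq_zero.2
  have key := fun y : {y : PrimeSpectrum B // y.asIdeal.IsMaximal} =>
    (hlocal y.1 y.2).exists_flat hBA d₁ d₂ hd₁ hd₂
  refine ⟨hne₁, hne₂, h₁, h₂, ?_, ?_⟩
  · choose _ C _ _ hflat hopen hmem c hc hcs using key
    obtain ⟨s, hs⟩ := KalimanKutzschebauch.exists_finset_cover_of_isMaximal _ hopen
      fun y hy => ⟨⟨y, hy⟩, hmem ⟨y, hy⟩⟩
    refine ⟨Ideal.span {∏ i ∈ s, c i}, ?_, ?_⟩
    · rw [Ne, Ideal.span_singleton_eq_bot]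
      exact Finset.prod_ne_zero_iff.2 fun i _ => hc i
    intro x hx
    obtain ⟨a, rfl⟩ := Ideal.mem_span_singleton'.1 hx
    simp only [← hd₁, ← hd₂]
    apply KalimanKutzschebauch.mem_span_of_mem_ker_mul_ker
    set S := LinearMap.ker (d₁ : A →ₗ[B] A) * LinearMap.ker (d₂ : A →ₗ[B] A)
    -- The colon ideal of the element in S. A maximal ideal containing it lies in the image of some
    -- Spec `C i`, where `c i` divides the product, and local membership gives a contradiction.
    let 𝔞 : Ideal B := S.comap (LinearMap.toSpanSingleton B A (a * ∏ i ∈ s, c i))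
    have htop : 𝔞 = ⊤ := by
      by_contra hne
      obtain ⟨m, hm, h𝔞m⟩ := Ideal.exists_le_maximal 𝔞 hne
      obtain ⟨i, his, Q, hQ⟩ := hs ⟨m, hm.isPrime⟩
      obtain ⟨e, he⟩ := Finset.dvd_prod_of_mem c his
      obtain ⟨b, hb, hbm⟩ := KalimanKutzschebauch.colon_not_le_of_mem_range_rTensor (C := C i) S
        (hcs i (e * a)) Q
      rw [hQ] at hbm
      refine hbm (h𝔞m ?_)
      rw [← mul_assoc, ← he, mul_comm] at hb
      exact hb
    have h1 : (1 : B) ∈ 𝔞 := htop ▸ Submodule.mem_top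
    simpa [𝔞] using h1
  · obtain ⟨m, hm⟩ := Ideal.exists_maximal B
    exact (key ⟨⟨m, hm.isPrime⟩, hm⟩).1
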